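/- **Theorem (Fractional Lieb–Thirring inequality).** Let $d\ge 1$ be an integer and let $s>0$ be real. There exists a constant $C>0$, depending only on $d$ and $s$, such that for all $N\in\mathbb{N}$ and every $L^2$-normalized $\Psi\in H^s(\mathbb{R}^{dN})$ (complex-valued, with no symmetry assumed), $$\Big\langle \Psi,\Big(\sum_{i=1}^N(-\Delta_i)^s+\sum_{1\le i<j\le N}\frac{1}{|x_i-x_j|^{2s}}\Big)\Psi\Big\rangle\ \ge\ C\int_{\mathbb{R}^d}\rho_\Psi(x)^{1+2s/d}\,dx .$$ Here points of $\mathbb{R}^{dN}$ are written $x=(x_1,\dots,x_N)$ with $x_i\in\mathbb{R}^d$, and $$\rho_\Psi(x):=\sum_{j=1}^N\int_{\mathbb{R}^{d(N-1)}}|\Psi(x_1,\dots,x_{j-1},x,x_{j+1},\dots,x_N)|^2\prod_{i\ne j}dx_i$$ is the one-body density. The left-hand side is understood as the sum of non-negative quadratic forms $$\sum_{i=1}^N\int_{\mathbb{R}^{dN}}|p_i|^{2s}\,|\widehat\Psi(p)|^2\,dp+\int_{\mathbb{R}^{dN}}\sum_{1\le i<j\le N}\frac{|\Psi(x)|^2}{|x_i-x_j|^{2s}}\,dx\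 \in[0,\infty],$$ where $\widehat\Psi(p)=(2\pi)^{-dN/2}\int_{\mathbb{R}^{dN}}\Psi(x)e^{-ip\cdot x}\,dx$ is the unitary Fourier transform on $L^2(\mathbb{R}^{dN})$; the inequality holds in $[0,\infty]$, and is trivial if the left-hand side is $+\infty$. -/

import Mathlib

open MeasureTheory FourierTransform
open scoped ENNReal

noncomputable section

/-- The configuration space `ℝ^{dN}` of `N` particles in `ℝ^d`, with its Euclidean norm and
Lebesgue measure. The coordinate `x (i, k)` is the `k`-th component of the particle `x_i`. -/
abbrev ConfigSpace (d N : ℕ) : Type :=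
  EuclideanSpace ℝ (Fin N × Fin d)

/-- The block `x_i ∈ ℝ^d` of `x = (x_1, …, x_N) ∈ ℝ^{dN}`. -/
def particle {d N : ℕ} (i : Fin N) (x : ConfigSpace d N) : EuclideanSpace ℝ (Fin d) :=
  WithLp.toLp 2 fun k => x (i, k)

/-- The point `(x_1, …, x_{j-1}, x, x_{j+1}, …, x_N)` of `ℝ^{dN}`, whose `j`-th block is `x` and
whose blocks `x_i` with `i ≠ j` are given by `y`. -/
def insertParticle {d N : ℕ} (j : Fin N) (x : EuclideanSpace ℝ (Fin d))
    (y : {i : Fin N // i ≠ j} → EuclideanSpace ℝ (Fin d)) : ConfigSpace d N :=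
  WithLp.toLp 2 fun p => if h : p.1 = j then x p.2 else y ⟨p.1, h⟩ p.2

/-- Complex-valued `L²` functions on `ℝ^{dN}`. -/
abbrev WaveFunction (d N : ℕ) : Type :=
  Lp (α := ConfigSpace d N) ℂ 2 volume

/-- Membership in `H^s(ℝ^{dN})`. -/
def WaveFunction.MemH {d N : ℕ} (Ψ : WaveFunction d N) (s : ℝ) : Prop :=
  TemperedDistribution.MemSobolev s 2 (Lp.toTemperedDistribution Ψ)

/-- The one-body density
`ρ_Ψ(x) = ∑_j ∫ |Ψ(x_1, …, x_{j-1}, x, x_{j+1}, …, x_N)|² ∏_{i ≠ j} dx_i`,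
as a function with values in `[0, ∞]`; up to null sets it does not depend on the
representative of `Ψ`. -/
def oneBodyDensity {d N : ℕ} (Ψ : WaveFunction d N) (x : EuclideanSpace ℝ (Fin d)) : ℝ≥0∞ :=
  ∑ j : Fin N, ∫⁻ y : {i : Fin N // i ≠ j} → EuclideanSpace ℝ (Fin d),
    ‖Ψ (insertParticle j x y)‖ₑ ^ 2

/-- The quadratic form `⟨Ψ, (-Δ_i)^s Ψ⟩ = ∫ |p_i|^{2s} |Ψ̂(p)|² dp` in `[0, ∞]`. Mathlib's Fourier
transform has the kernel `exp (-2πi ⟨x, ξ⟩)`, so that `p = 2πξ`. -/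
def kineticForm {d N : ℕ} (s : ℝ) (i : Fin N) (Ψ : WaveFunction d N) : ℝ≥0∞ :=
  ∫⁻ ξ : ConfigSpace d N,
    ENNReal.ofReal ((2 * Real.pi * ‖particle i ξ‖) ^ (2 * s)) *
      ‖(𝓕 Ψ : WaveFunction d N) ξ‖ₑ ^ 2

/-- The quadratic form `⟨Ψ, ∑_{i<j} |x_i - x_j|^{-2s} Ψ⟩ = ∫ ∑_{i<j} |x_i - x_j|^{-2s} |Ψ(x)|² dx`
in `[0, ∞]`. -/
def interactionForm {d N : ℕ} (s : ℝ) (Ψ : WaveFunction d N) : ℝ≥0∞ :=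
  ∫⁻ x : ConfigSpace d N,
    (∑ i : Fin N, ∑ j ∈ Finset.Ioi i, edist (particle i x) (particle j x) ^ (-(2 * s))) *
      ‖Ψ x‖ₑ ^ 2

/-- The form `⟨Ψ, (∑_i (-Δ_i)^s + ∑_{i<j} |x_i - x_j|^{-2s}) Ψ⟩`, as the sum of the two
non-negative forms. It is `∞` if `Ψ` is not in the form domain. -/
def energyForm {d N : ℕ} (s : ℝ) (Ψ : WaveFunction d N) : ℝ≥0∞ :=
  (∑ i : Fin N, kineticForm s i Ψ) + interactionForm s Ψ

end

/-!
The proof compares both sides pointwise in `x`, at the length scale `l` for which `l ^ d` is a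
large multiple of `1 / ρ x`, where `ρ` is the one-body density.

Fix an integer `m > s`. The value of `Ψ` at a configuration is controlled by its `m`-th finite
difference with step `h` in one particle and by the values of `Ψ` at the `m` other nodes
(`enorm_sq_le_fwdDiff_iter`). Squaring, integrating out the other particles and averaging over
`|h| < l` bounds `l ^ d * ρ x` by the integral over `|h| < l` of the density of the finite
differences (`fwdDiffDensity`), plus a multiple of the expected number of particles in the ball of
radius `m * l` about `x`. As `n` particles form at least `n - 1` pairs, this number is at most one
more than the expected number of pairs in that ball (`setLIntegral_ball_oneBodyDensity_le`). If
fewer than one pair is expected, the choice of `l` lets the second term be absorbed, and the finite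
differences carry the density; otherwise pairs occur at all radii in `[m * l, 2 * m * l]`. In
either case `ρ x ^ (1 + 2 * s / d)`, which is comparable to `l ^ (-d - 2 * s)`, is bounded by
`∫ |h| ^ (-d - 2 * s) * fwdDiffDensity m Ψ h x dh` plus
`∫ r ^ (-1 - d - 2 * s) * expectedPairs Ψ x r dr`, up to a constant
(`exists_rpow_le_lintegral_add_lintegral`).

Integrated over `x`, the first expression is a Gagliardo form of order `m`, which Plancherel's
theorem bounds by the kinetic energy because `m > s` (`exists_lintegral_fwdDiffDensity_le`). The
second one is a Fefferman–de la Llave representation of the potential `|x - y| ^ (-2 * s)`, which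
gives the interaction energy (`exists_lintegral_expectedPairs_le`).
-/

/-! ### Finite differences under the Fourier transform -/

section Fourier

variable {E : Type*} [NormedAddCommGroup E] [InnerProductSpace ℝ E] [FiniteDimensional ℝ E]
  [MeasurableSpace E] [BorelSpace E]

/-- Translation `f ↦ f (· + a)` as a linear isometry of `L²`. -/
noncomputable def translateL2 (a : E) : Lp (α := E) ℂ 2 volume →ₗᵢ[ℂ] Lp (α := E) ℂ 2 volume :=
  Lp.compMeasurePreservingₗᵢ ℂ (· + a) (measurePreserving_add_right volume a)

theorem coeFn_translateL2 (a : E) (f : Lp (α := E) ℂ 2 volume) :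
    translateL2 a f =ᵐ[volume] fun x => f (x + a) :=
  Lp.coeFn_compMeasurePreserving f (measurePreserving_add_right volume a)

/-- The character `ξ ↦ exp (2πi ⟨a, ξ⟩)` as a bounded multiplier. -/
noncomputable def fourierCharTop (a : E) : Lp (α := E) ℂ ∞ volume :=
  (memLp_top_of_bound (f := fun ξ : E => ((Real.fourierChar (inner ℝ a ξ) : Circle) : ℂ))
    (Continuous.aestronglyMeasurable (by fun_prop)) 1
      (.of_forall fun ξ => (Circle.norm_coe _).le)).toLp _

theorem coeFn_fourierCharTop (a : E) :
    fourierCharTop a =ᵐ[volume] fun ξ : E => ((Real.fourierChar (inner ℝ a ξ) : Circle) : ℂ) :=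
  MemLp.coeFn_toLp _

theorem translateL2_toLp (a : E) (f : SchwartzMap E ℂ) :
    translateL2 a (f.toLp 2) = (f.compSubConstCLM ℂ (-a)).toLp 2 := by
  refine Lp.ext ?_
  have h := (measurePreserving_add_right (volume : Measure E) a).quasiMeasurePreserving.ae_eq_comp
    (f.coeFn_toLp 2 volume)
  filter_upwards [coeFn_translateL2 a (f.toLp 2),
    (f.compSubConstCLM ℂ (-a)).coeFn_toLp 2 volume, h] with x h1 h2 h3
  rw [h1, h2]
  simpa using h3

theorem fourier_compSubConstCLM_apply (a : E) (f : SchwartzMap E ℂ) (ξ : E) :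
    𝓕 (f.compSubConstCLM ℂ (-a)) ξ =
      ((Real.fourierChar (inner ℝ a ξ) : Circle) : ℂ) * 𝓕 f ξ := by
  have h := congrFun (VectorFourier.fourierIntegral_comp_add_right Real.fourierChar
    (volume : Measure E) (innerₗ E) f a) ξ
  rw [SchwartzMap.fourier_coe, SchwartzMap.fourier_coe]
  have h2 : (f.compSubConstCLM ℂ (-a) : E → ℂ) = (f : E → ℂ) ∘ fun v => v + a := by
    ext x; simp
  rw [h2]
  exact h

/-- The Fourier transform on `L²` turns translations into multiplication by characters. -/
theorem fourier_translateL2 (a : E) (f : Lp (α := E) ℂ 2 volume) :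
    𝓕 (translateL2 a f) = (fourierCharTop a • 𝓕 f : Lp (α := E) ℂ 2 volume) := by
  have hc : Continuous fun g : Lp (α := E) ℂ 2 volume =>
      (fourierCharTop a • g : Lp (α := E) ℂ 2 volume) :=
    ((ContinuousLinearMap.mul ℂ ℂ).holderL volume ∞ 2 2 (fourierCharTop a)).continuous
  refine DenseRange.induction_on
    (p := fun f => 𝓕 (translateL2 a f) = (fourierCharTop a • 𝓕 f : Lp (α := E) ℂ 2 volume))
    (SchwartzMap.denseRange_toLpCLM (p := 2) (μ := volume) (F := ℂ) ENNReal.ofNat_ne_top) f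
    (isClosed_eq ?_ ?_) ?_
  · exact (Lp.fourierTransformₗᵢ E ℂ).continuous.comp (translateL2 a).continuous
  · exact hc.comp (Lp.fourierTransformₗᵢ E ℂ).continuous
  · intro f
    rw [SchwartzMap.toLpCLM_apply, translateL2_toLp, SchwartzMap.toLp_fourier_eq,
      SchwartzMap.toLp_fourier_eq]
    refine Lp.ext ?_
    filter_upwards [(𝓕 (f.compSubConstCLM ℂ (-a))).coeFn_toLp 2 volume,
      Lp.coeFn_lpSMul (r := 2) (fourierCharTop a) ((𝓕 f).toLp 2 volume), coeFn_fourierCharTop a,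
      (𝓕 f).coeFn_toLp 2 volume] with ξ h1 h2 h3 h4
    rw [h1, h2, Pi.smul_apply', h3, h4, fourier_compSubConstCLM_apply, smul_eq_mul]

theorem coeFn_fourier_translateL2_sub (a : E) (f : Lp (α := E) ℂ 2 volume) :
    ⇑(𝓕 (translateL2 a f - f) : Lp (α := E) ℂ 2 volume) =ᵐ[volume]
      fun ξ => (((Real.fourierChar (inner ℝ a ξ) : Circle) : ℂ) - 1) *
        (𝓕 f : Lp (α := E) ℂ 2 volume) ξ := by
  have h : 𝓕 (translateL2 a f - f) = (fourierCharTop a • 𝓕 f : Lp (α := E) ℂ 2 volume) - 𝓕 f := by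
    rw [← fourier_translateL2]
    exact (Lp.fourierTransformₗᵢ E ℂ).map_sub _ _
  rw [h]
  filter_upwards [Lp.coeFn_sub (fourierCharTop a • 𝓕 f : Lp (α := E) ℂ 2 volume) (𝓕 f),
    Lp.coeFn_lpSMul (r := 2) (fourierCharTop a) (𝓕 f), coeFn_fourierCharTop a] with ξ h1 h2 h3
  rw [h1, Pi.sub_apply, h2, Pi.smul_apply', h3, smul_eq_mul]
  ring

theorem lintegral_enorm_sq_eq (f : Lp (α := E) ℂ 2 volume) :
    ∫⁻ x, ‖f x‖ₑ ^ 2 = ‖f‖ₑ ^ 2 := by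
  have h := eLpNorm_nnreal_pow_eq_lintegral (f := f) (μ := volume) (p := 2) two_ne_zero
  simp only [NNReal.coe_ofNat, ENNReal.rpow_ofNat] at h
  rw [← h, Lp.enorm_def]
  rfl

/-- Plancherel's theorem for iterated finite differences. -/
theorem lintegral_enorm_fwdDiff_iter_sq (a : E) (m : ℕ) (f : Lp (α := E) ℂ 2 volume) :
    ∫⁻ x, ‖(fwdDiff a)^[m] (⇑f) x‖ₑ ^ 2 =
      ∫⁻ ξ, ‖((Real.fourierChar (inner ℝ a ξ) : Circle) : ℂ) - 1‖ₑ ^ (2 * m) *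
        ‖(𝓕 f : Lp (α := E) ℂ 2 volume) ξ‖ₑ ^ 2 := by
  obtain ⟨g, hg, hgF⟩ : ∃ g : Lp (α := E) ℂ 2 volume, g =ᵐ[volume] (fwdDiff a)^[m] (⇑f) ∧
      ⇑(𝓕 g : Lp (α := E) ℂ 2 volume) =ᵐ[volume] fun ξ =>
        (((Real.fourierChar (inner ℝ a ξ) : Circle) : ℂ) - 1) ^ m *
          (𝓕 f : Lp (α := E) ℂ 2 volume) ξ := by
    induction m with
    | zero => exact ⟨f, by simp, by simp⟩
    | succ m ih =>
      obtain ⟨g, hg, hgF⟩ := ih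
      refine ⟨translateL2 a g - g, ?_, ?_⟩
      · have h := (measurePreserving_add_right
          (volume : Measure E) a).quasiMeasurePreserving.ae_eq_comp hg
        filter_upwards [Lp.coeFn_sub (translateL2 a g) g, coeFn_translateL2 a g, h, hg]
          with x h1 h2 h3 h4
        rw [Function.comp_apply, Function.comp_apply] at h3
        rw [Function.iterate_succ_apply', h1, Pi.sub_apply, h2, h4, h3]
        rfl
      · filter_upwards [coeFn_fourier_translateL2_sub a g, hgF] with ξ h1 h2
        rw [h1, h2]
        ring
  have h1 : ∫⁻ x, ‖(fwdDiff a)^[m] (⇑f) x‖ₑ ^ 2 = ∫⁻ x, ‖g x‖ₑ ^ 2 :=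
    lintegral_congr_ae (by filter_upwards [hg] with x hx; rw [hx])
  have h2 : ‖𝓕 g‖ₑ = ‖g‖ₑ := by
    rw [← ofReal_norm, Lp.norm_fourier_eq, ofReal_norm]
  rw [h1, lintegral_enorm_sq_eq, ← h2, ← lintegral_enorm_sq_eq]
  refine lintegral_congr_ae ?_
  filter_upwards [hgF] with ξ hξ
  rw [hξ, enorm_mul, enorm_pow, mul_pow, ← pow_mul, mul_comm m 2]

end Fourier

/-! ### Integrating out all particles but one -/

section Marginal

variable {d N : ℕ}

theorem particle_insertParticle_self (j : Fin N) (x : EuclideanSpace ℝ (Fin d))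
    (y : {i : Fin N // i ≠ j} → EuclideanSpace ℝ (Fin d)) :
    particle j (insertParticle j x y) = x := by
  ext k
  simp [particle, insertParticle]

theorem insertParticle_add (j : Fin N) (x h : EuclideanSpace ℝ (Fin d))
    (y : {i : Fin N // i ≠ j} → EuclideanSpace ℝ (Fin d)) :
    insertParticle j (x + h) y = insertParticle j x y + insertParticle j h 0 := by
  ext p
  by_cases hp : p.1 = j <;> simp [insertParticle, hp]

theorem nsmul_insertParticle_zero (j : Fin N) (h : EuclideanSpace ℝ (Fin d)) (k : ℕ) :
    k • insertParticle j h 0 = insertParticle j (k • h) 0 := by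
  ext p
  by_cases hp : p.1 = j <;> simp [insertParticle, hp]

theorem inner_insertParticle_zero (j : Fin N) (h : EuclideanSpace ℝ (Fin d))
    (ξ : ConfigSpace d N) :
    inner ℝ (insertParticle j h 0) ξ = inner ℝ h (particle j ξ) := by
  simp only [PiLp.inner_apply, insertParticle, particle, Fintype.sum_prod_type]
  rw [Finset.sum_eq_single j]
  · simp
  · intro i _ hi
    simp [hi]
  · simp

@[fun_prop]
theorem measurable_particle (j : Fin N) : Measurable (particle (d := d) j) := by
  unfold particle
  fun_prop

theorem measurable_insertParticle (j : Fin N) :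
    Measurable fun p : EuclideanSpace ℝ (Fin d) ×
      ({i : Fin N // i ≠ j} → EuclideanSpace ℝ (Fin d)) => insertParticle j p.1 p.2 := by
  unfold insertParticle
  refine (WithLp.measurable_toLp 2 _).comp (measurable_pi_lambda _ fun p => ?_)
  by_cases h : p.1 = j
  · simp only [h, dite_true]
    fun_prop
  · simp only [h, dite_false]
    fun_prop

/-- On a product of measurable rectangles, both sides are the product of the one-dimensional
volumes. -/
theorem measurePreserving_insertParticle (j : Fin N) :
    MeasurePreserving (fun p : EuclideanSpace ℝ (Fin d) ×
      ({i : Fin N // i ≠ j} → EuclideanSpace ℝ (Fin d)) => insertParticle j p.1 p.2) := by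
  have hm := measurable_insertParticle (d := d) j
  have key : MeasurePreserving ((WithLp.ofLp (p := 2)) ∘
      fun p : EuclideanSpace ℝ (Fin d) ×
        ({i : Fin N // i ≠ j} → EuclideanSpace ℝ (Fin d)) => insertParticle j p.1 p.2)
      volume (volume : Measure (Fin N × Fin d → ℝ)) := by
    refine ⟨(WithLp.measurable_ofLp 2 _).comp hm, ?_⟩
    refine (Measure.pi_eq fun t ht => ?_).symm
    let B : Fin N → Set (EuclideanSpace ℝ (Fin d)) := fun i =>
      (WithLp.ofLp (p := 2)) ⁻¹' (Set.univ.pi fun k => t (i, k))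
    have hB : ∀ i, volume (B i) = ∏ k, volume (t (i, k)) := fun i => by
      rw [(PiLp.volume_preserving_ofLp (Fin d)).measure_preimage
        (MeasurableSet.univ_pi fun k => ht _).nullMeasurableSet, volume_pi_pi]
    have hpre : ((WithLp.ofLp (p := 2)) ∘ fun p : EuclideanSpace ℝ (Fin d) ×
        ({i : Fin N // i ≠ j} → EuclideanSpace ℝ (Fin d)) => insertParticle j p.1 p.2) ⁻¹'
        (Set.univ.pi t) = B j ×ˢ Set.univ.pi fun i : {i : Fin N // i ≠ j} => B i := by
      ext ⟨x, y⟩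
      simp only [Set.mem_preimage, Set.mem_pi, Set.mem_univ, true_imp_iff, Set.mem_prod,
        Function.comp_apply, insertParticle, B]
      constructor
      · intro h
        refine ⟨fun k => by simpa using h (j, k), fun i k => by simpa [i.2] using h (i, k)⟩
      · rintro ⟨h1, h2⟩ ⟨i, k⟩
        by_cases hi : i = j
        · subst hi
          simpa using h1 k
        · simpa [hi] using h2 ⟨i, hi⟩ k
    rw [Measure.map_apply ((WithLp.measurable_ofLp 2 _).comp hm)
      (MeasurableSet.univ_pi ht), hpre, Measure.volume_eq_prod, Measure.prod_prod, volume_pi_pi,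
      Fintype.prod_prod_type, hB]
    simp_rw [hB]
    rw [← Fintype.prod_subtype_mul_prod_subtype (fun i => i = j)]
    simp
    rfl
  exact (PiLp.volume_preserving_toLp (Fin N × Fin d)).comp key

/-- The density at `x` of the `j`-th particle, when the configuration has density `f`: the
integral of `f` over the positions of all other particles. -/
noncomputable def particleDensity (j : Fin N) (f : ConfigSpace d N → ℝ≥0∞)
    (x : EuclideanSpace ℝ (Fin d)) : ℝ≥0∞ :=
  ∫⁻ y : {i : Fin N // i ≠ j} → EuclideanSpace ℝ (Fin d), f (insertParticle j x y)

theorem measurable_particleDensity_prod {β : Type*} [MeasurableSpace β] (j : Fin N)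
    {f : β → ConfigSpace d N → ℝ≥0∞} (hf : Measurable fun q : β × ConfigSpace d N => f q.1 q.2) :
    Measurable fun p : β × EuclideanSpace ℝ (Fin d) => particleDensity j (f p.1) p.2 := by
  have hm : Measurable fun q : (β × EuclideanSpace ℝ (Fin d)) ×
      ({i : Fin N // i ≠ j} → EuclideanSpace ℝ (Fin d)) =>
      (q.1.1, insertParticle j q.1.2 q.2) :=
    measurable_fst.fst.prodMk
      ((measurable_insertParticle j).comp (measurable_fst.snd.prodMk measurable_snd))
  exact (hf.comp hm).lintegral_prod_right'

theorem measurable_particleDensity (j : Fin N) {f : ConfigSpace d N → ℝ≥0∞} (hf : Measurable f) :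
    Measurable (particleDensity j f) :=
  (measurable_particleDensity_prod (β := Unit) (f := fun _ => f) j
    (hf.comp measurable_snd)).comp ((measurable_const (a := ())).prodMk measurable_id)

theorem lintegral_mul_particleDensity (j : Fin N) {g : EuclideanSpace ℝ (Fin d) → ℝ≥0∞}
    (hg : Measurable g) {f : ConfigSpace d N → ℝ≥0∞} (hf : Measurable f) :
    ∫⁻ x, g x * particleDensity j f x = ∫⁻ X, g (particle j X) * f X := by
  have h := (measurePreserving_insertParticle (d := d) j).lintegral_comp
    ((hg.comp (measurable_particle j)).mul hf)
  have hm : Measurable fun p : EuclideanSpace ℝ (Fin d) ×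
      ({i : Fin N // i ≠ j} → EuclideanSpace ℝ (Fin d)) =>
      g (particle j (insertParticle j p.1 p.2)) * f (insertParticle j p.1 p.2) :=
    ((hg.comp (measurable_particle j)).mul hf).comp (measurable_insertParticle j)
  simp only [Pi.mul_apply, Function.comp_apply] at h
  rw [← h, Measure.volume_eq_prod, lintegral_prod _ hm.aemeasurable]
  refine lintegral_congr fun x => ?_
  simp only [particle_insertParticle_self]
  exact (lintegral_const_mul _ (hf.comp ((measurable_insertParticle j).comp
    (measurable_const.prodMk measurable_id)))).symm

theorem lintegral_particleDensity (j : Fin N) {f : ConfigSpace d N → ℝ≥0∞} (hf : Measurable f) :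
    ∫⁻ x, particleDensity j f x = ∫⁻ X, f X := by
  simpa using lintegral_mul_particleDensity j (g := fun _ => 1) measurable_const hf

theorem particleDensity_add (j : Fin N) (f : ConfigSpace d N → ℝ≥0∞)
    (x h : EuclideanSpace ℝ (Fin d)) :
    particleDensity j f (x + h) = particleDensity j (fun X => f (X + insertParticle j h 0)) x := by
  simp only [particleDensity, insertParticle_add]

end Marginal

/-! ### Radial integrals -/

section Radial

/-- Integration of a radial function in polar coordinates. -/
theorem lintegral_fun_norm_addHaar {E : Type*} [NormedAddCommGroup E] [NormedSpace ℝ E]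
    [Nontrivial E] [FiniteDimensional ℝ E] [MeasurableSpace E] [BorelSpace E] (μ : Measure E)
    [μ.IsAddHaarMeasure] {f : ℝ → ℝ≥0∞} (hf : Measurable f) :
    ∫⁻ x, f ‖x‖ ∂μ = Module.finrank ℝ E * μ (Metric.ball 0 1) *
      ∫⁻ r in Set.Ioi (0 : ℝ), ENNReal.ofReal (r ^ (Module.finrank ℝ E - 1)) * f r := by
  calc ∫⁻ x, f ‖x‖ ∂μ
      = ∫⁻ x : ({(0)}ᶜ : Set E), f ‖x.1‖ ∂(μ.comap (↑)) := by
        rw [lintegral_subtype_comap (measurableSet_singleton _).compl fun x => f ‖x‖,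
          restrict_compl_singleton]
    _ = ∫⁻ x, f x.2 ∂μ.toSphere.prod (.volumeIoiPow (Module.finrank ℝ E - 1)) := by
        simpa using μ.measurePreserving_homeomorphUnitSphereProd.lintegral_comp_emb
          (Homeomorph.measurableEmbedding _) (fun x => f x.2)
    _ = μ.toSphere Set.univ *
        ∫⁻ x : Set.Ioi (0 : ℝ), f x ∂.volumeIoiPow (Module.finrank ℝ E - 1) := by
        rw [lintegral_prod _ (by fun_prop)]
        simp [mul_comm]
    _ = _ := by
        rw [μ.toSphere_apply_univ, Measure.volumeIoiPow,
          lintegral_withDensity_eq_lintegral_mul _ (by fun_prop) (by fun_prop)]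
        rw [← lintegral_subtype_comap measurableSet_Ioi
          (fun r => ENNReal.ofReal (r ^ (Module.finrank ℝ E - 1)) * f r)]
        rfl

theorem lintegral_Ioi_rpow {a c : ℝ} (ha : a < -1) (hc : 0 < c) :
    ∫⁻ r in Set.Ioi c, ENNReal.ofReal (r ^ a) = ENNReal.ofReal (-c ^ (a + 1) / (a + 1)) := by
  rw [← ofReal_integral_eq_lintegral_ofReal (integrableOn_Ioi_rpow_of_lt ha hc),
    integral_Ioi_rpow_of_lt ha hc]
  filter_upwards [ae_restrict_mem measurableSet_Ioi] with r hr
  exact Real.rpow_nonneg (hc.trans hr).le _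

theorem lintegral_Ioc_rpow {a c : ℝ} (ha : -1 < a) (hc : 0 ≤ c) :
    ∫⁻ r in Set.Ioc 0 c, ENNReal.ofReal (r ^ a) = ENNReal.ofReal (c ^ (a + 1) / (a + 1)) := by
  rw [← ofReal_integral_eq_lintegral_ofReal
    (intervalIntegral.intervalIntegrable_rpow' ha).1, ← intervalIntegral.integral_of_le hc,
    integral_rpow (.inl ha), Real.zero_rpow (by linarith), sub_zero]
  filter_upwards [ae_restrict_mem measurableSet_Ioc] with r hr
  exact Real.rpow_nonneg hr.1.le _

theorem norm_fourierChar_sub_one_le (t : ℝ) :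
    ‖((Real.fourierChar t : Circle) : ℂ) - 1‖ ≤ 2 * Real.pi * |t| := by
  have h := Real.norm_exp_I_mul_ofReal_sub_one_le (x := 2 * Real.pi * t)
  rw [Real.fourierChar_apply, mul_comm _ Complex.I]
  refine h.trans_eq ?_
  rw [norm_mul, Real.norm_eq_abs, abs_of_pos Real.two_pi_pos, Real.norm_eq_abs]

theorem norm_fourierChar_sub_one_le_two (t : ℝ) :
    ‖((Real.fourierChar t : Circle) : ℂ) - 1‖ ≤ 2 := by
  refine (norm_sub_le _ _).trans ?_
  rw [Circle.norm_coe, norm_one]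
  norm_num

/-- The symbol of the Gagliardo form of order `m > s` is at most a multiple of `|2πp|^{2s}`. The
finite difference controls the singularity at `h = 0`, where its symbol has a zero of
order `2m > 2s`. -/
theorem exists_lintegral_fourierChar_sub_one_le {d : ℕ} (hd : 1 ≤ d) {s : ℝ} (hs : 0 < s) {m : ℕ}
    (hm : s < m) :
    ∃ C : ℝ≥0∞, C ≠ ∞ ∧ ∀ p : EuclideanSpace ℝ (Fin d),
      ∫⁻ h : EuclideanSpace ℝ (Fin d), ENNReal.ofReal (‖h‖ ^ (-(d + 2 * s))) *
        ‖((Real.fourierChar (inner ℝ h p) : Circle) : ℂ) - 1‖ₑ ^ (2 * m) ≤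
      C * ENNReal.ofReal ((2 * Real.pi * ‖p‖) ^ (2 * s)) := by
  have : Nonempty (Fin d) := ⟨⟨0, hd⟩⟩
  set V : ℝ≥0∞ := volume (Metric.ball (0 : EuclideanSpace ℝ (Fin d)) 1)
  have hm0 : m ≠ 0 := by
    rintro rfl
    rw [Nat.cast_zero] at hm
    linarith
  have hV : V ≠ ∞ := measure_ball_lt_top.ne
  refine ⟨d * V * ENNReal.ofReal (1 / (2 * m - 2 * s) + 4 ^ m / (2 * s)),
    by finiteness, fun p => ?_⟩
  obtain rfl | hp := eq_or_ne p 0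
  · simp [hm0]
  have hq : 0 < 2 * Real.pi * ‖p‖ := by positivity
  set q := 2 * Real.pi * ‖p‖ with hqdef
  let f : ℝ → ℝ≥0∞ := fun r => ENNReal.ofReal (r ^ (-(d + 2 * s))) *
    ENNReal.ofReal (min ((q * r) ^ (2 * m)) (4 ^ m))
  have hf : Measurable f := by fun_prop
  calc ∫⁻ h : EuclideanSpace ℝ (Fin d), ENNReal.ofReal (‖h‖ ^ (-(d + 2 * s))) *
        ‖((Real.fourierChar (inner ℝ h p) : Circle) : ℂ) - 1‖ₑ ^ (2 * m)
      ≤ ∫⁻ h : EuclideanSpace ℝ (Fin d), f ‖h‖ := by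
        refine lintegral_mono fun h => ?_
        refine mul_le_mul_right ?_ _
        rw [← ofReal_norm, ← ENNReal.ofReal_pow (norm_nonneg _)]
        refine ENNReal.ofReal_le_ofReal (le_min ?_ ?_)
        · refine pow_le_pow_left₀ (norm_nonneg _) ((norm_fourierChar_sub_one_le _).trans ?_) _
          have := abs_real_inner_le_norm h p
          calc 2 * Real.pi * |inner ℝ h p| ≤ 2 * Real.pi * (‖h‖ * ‖p‖) := by gcongr
            _ = q * ‖h‖ := by rw [hqdef]; ring
        · refine (pow_le_pow_left₀ (norm_nonneg _) (norm_fourierChar_sub_one_le_two _) _).trans_eq ?_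
          rw [pow_mul]
          norm_num
    _ = d * V * ∫⁻ r in Set.Ioi (0 : ℝ), ENNReal.ofReal (r ^ (d - 1)) * f r := by
        rw [lintegral_fun_norm_addHaar volume hf, finrank_euclideanSpace_fin]
    _ ≤ d * V * (ENNReal.ofReal (1 / (2 * m - 2 * s) + 4 ^ m / (2 * s)) *
          ENNReal.ofReal (q ^ (2 * s))) := by
        refine mul_le_mul_right ?_ _
        -- at `r = 1 / q` the two bounds on the finite difference are comparable
        have hu : Set.Ioi (0 : ℝ) = Set.Ioc 0 q⁻¹ ∪ Set.Ioi q⁻¹ :=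
          (Set.Ioc_union_Ioi_eq_Ioi (by positivity)).symm
        have hr : ∀ r : ℝ, 0 < r → r ^ (d - 1) * r ^ (-(d + 2 * s)) = r ^ (-1 - 2 * s) := by
          intro r hr
          rw [← Real.rpow_natCast, ← Real.rpow_add hr, Nat.cast_sub hd]
          congr 1
          push_cast
          ring
        rw [hu, lintegral_union measurableSet_Ioi
          (Set.disjoint_left.2 fun r h1 h2 => absurd h1.2 (not_le.2 h2))]
        have h1 : ∫⁻ r in Set.Ioc 0 q⁻¹, ENNReal.ofReal (r ^ (d - 1)) * f r ≤
            ENNReal.ofReal (q ^ (2 * s) / (2 * m - 2 * s)) := by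
          calc ∫⁻ r in Set.Ioc 0 q⁻¹, ENNReal.ofReal (r ^ (d - 1)) * f r
              ≤ ∫⁻ r in Set.Ioc 0 q⁻¹, ENNReal.ofReal (q ^ (2 * m)) *
                  ENNReal.ofReal (r ^ (-1 - 2 * s + 2 * m)) := by
                refine setLIntegral_mono' measurableSet_Ioc fun r hr0 => ?_
                have hr0 := hr0.1
                simp only [f]
                rw [← ENNReal.ofReal_mul (by positivity), ← ENNReal.ofReal_mul (by positivity),
                  ← ENNReal.ofReal_mul (by positivity)]
                refine ENNReal.ofReal_le_ofReal ?_
                rw [← mul_assoc, hr r hr0, Real.rpow_add hr0]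
                refine (mul_le_mul_of_nonneg_left (min_le_left _ _) (by positivity)).trans_eq ?_
                rw [mul_pow, ← Real.rpow_natCast r]
                push_cast
                ring
            _ = _ := by
                rw [lintegral_const_mul _ (by fun_prop),
                  lintegral_Ioc_rpow (by linarith) (by positivity),
                  ← ENNReal.ofReal_mul (by positivity)]
                congr 1
                rw [show -1 - 2 * s + 2 * (m : ℝ) + 1 = 2 * m - 2 * s by ring,
                  Real.inv_rpow hq.le, ← Real.rpow_neg hq.le, ← Real.rpow_natCast q,
                  ← mul_div_assoc, ← Real.rpow_add hq]
                congr 2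
                push_cast
                ring
        have h2 : ∫⁻ r in Set.Ioi q⁻¹, ENNReal.ofReal (r ^ (d - 1)) * f r ≤
            ENNReal.ofReal (4 ^ m * q ^ (2 * s) / (2 * s)) := by
          calc ∫⁻ r in Set.Ioi q⁻¹, ENNReal.ofReal (r ^ (d - 1)) * f r
              ≤ ∫⁻ r in Set.Ioi q⁻¹, ENNReal.ofReal (4 ^ m) *
                  ENNReal.ofReal (r ^ (-1 - 2 * s)) := by
                refine setLIntegral_mono' measurableSet_Ioi fun r hr0 => ?_
                have hr0 : 0 < r := lt_trans (by positivity) hr0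
                simp only [f]
                rw [← ENNReal.ofReal_mul (by positivity), ← ENNReal.ofReal_mul (by positivity),
                  ← ENNReal.ofReal_mul (by positivity)]
                refine ENNReal.ofReal_le_ofReal ?_
                rw [← mul_assoc, hr r hr0, mul_comm]
                exact mul_le_mul_of_nonneg_right (min_le_right _ _) (by positivity)
            _ = _ := by
                rw [lintegral_const_mul _ (by fun_prop),
                  lintegral_Ioi_rpow (by linarith) (by positivity),
                  ← ENNReal.ofReal_mul (by positivity)]
                congr 1
                rw [Real.inv_rpow hq.le, ← Real.rpow_neg hq.le,
                  show -(-1 - 2 * s + 1) = 2 * s by ring, show -1 - 2 * s + 1 = -(2 * s) by ring,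
                  neg_div_neg_eq, mul_div_assoc]
        have hms : 0 < 2 * (m : ℝ) - 2 * s := by linarith
        refine (add_le_add h1 h2).trans_eq ?_
        rw [← ENNReal.ofReal_mul (by positivity), ← ENNReal.ofReal_add (by positivity)
          (by positivity)]
        congr 1
        ring
    _ = _ := by simp only [mul_assoc]

/-- The Fefferman–de la Llave bound: the part of the potential `|x - y|^{-2s}` seen by balls
that contain both points. -/
theorem exists_lintegral_volume_ball_inter_ball_le {d : ℕ} (hd : 1 ≤ d) {s : ℝ} (hs : 0 < s) :
    ∃ C : ℝ≥0∞, C ≠ ∞ ∧ ∀ x y : EuclideanSpace ℝ (Fin d),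
      ∫⁻ r in Set.Ioi (0 : ℝ), ENNReal.ofReal (r ^ (-(1 + d + 2 * s))) *
        volume (Metric.ball x r ∩ Metric.ball y r) ≤ C * edist x y ^ (-(2 * s)) := by
  have : Nonempty (Fin d) := ⟨⟨0, hd⟩⟩
  set V : ℝ≥0∞ := volume (Metric.ball (0 : EuclideanSpace ℝ (Fin d)) 1)
  have hV : V ≠ ∞ := measure_ball_lt_top.ne
  have hV0 : V ≠ 0 := (Metric.measure_ball_pos _ _ one_pos).ne'
  refine ⟨V * ENNReal.ofReal (2 ^ (2 * s) / (2 * s)), by finiteness, fun x y => ?_⟩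
  obtain rfl | hxy := eq_or_ne x y
  · rw [edist_self, ENNReal.zero_rpow_of_neg (by linarith), ENNReal.mul_top]
    · exact le_top
    · exact mul_ne_zero hV0 (ENNReal.ofReal_pos.2 (by positivity)).ne'
  have hD : 0 < dist x y := dist_pos.2 hxy
  -- the two balls are disjoint unless `r` exceeds half the distance
  have hle : ∀ r ∈ Set.Ioi (0 : ℝ), ENNReal.ofReal (r ^ (-(1 + d + 2 * s))) *
        volume (Metric.ball x r ∩ Metric.ball y r) ≤
      (Set.Ioi (dist x y / 2)).indicator
        (fun r => V * ENNReal.ofReal (r ^ (-1 - 2 * s))) r := by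
    intro r hr
    have hr : 0 < r := hr
    by_cases h : r ∈ Set.Ioi (dist x y / 2)
    · rw [Set.indicator_of_mem h]
      calc _ ≤ ENNReal.ofReal (r ^ (-(1 + d + 2 * s))) * volume (Metric.ball x r) :=
            mul_le_mul_right (measure_mono Set.inter_subset_left) _
        _ = _ := by
          rw [Measure.addHaar_ball _ _ hr.le, finrank_euclideanSpace_fin, ← mul_assoc,
            ← ENNReal.ofReal_mul (by positivity), ← Real.rpow_natCast, ← Real.rpow_add hr,
            mul_comm]
          congr 3
          ring
    · have : Metric.ball x r ∩ Metric.ball y r = ∅ := by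
        refine Set.disjoint_iff_inter_eq_empty.1 (Metric.ball_disjoint_ball ?_)
        have : r ≤ dist x y / 2 := not_lt.1 h
        linarith
      simp [this]
  calc _ ≤ ∫⁻ r in Set.Ioi (0 : ℝ), (Set.Ioi (dist x y / 2)).indicator
        (fun r => V * ENNReal.ofReal (r ^ (-1 - 2 * s))) r :=
        setLIntegral_mono' measurableSet_Ioi hle
    _ ≤ ∫⁻ r : ℝ, (Set.Ioi (dist x y / 2)).indicator
        (fun r => V * ENNReal.ofReal (r ^ (-1 - 2 * s))) r := setLIntegral_le_lintegral _ _
    _ = V * ENNReal.ofReal (2 ^ (2 * s) / (2 * s)) * edist x y ^ (-(2 * s)) := by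
        rw [lintegral_indicator measurableSet_Ioi, lintegral_const_mul _ (by fun_prop),
          lintegral_Ioi_rpow (by linarith) (by positivity), mul_assoc, edist_dist,
          ENNReal.ofReal_rpow_of_pos hD, ← ENNReal.ofReal_mul (by positivity)]
        congr 2
        rw [show -1 - 2 * s + 1 = -(2 * s) by ring, neg_div_neg_eq,
          Real.div_rpow hD.le (by norm_num), Real.rpow_neg (by norm_num : (0 : ℝ) ≤ 2)]
        field_simp

end Radial

/-! ### Pointwise bounds -/

section Pointwise

/-- A function is controlled by its `m`-th finite difference and by its values at the `m` other
nodes. -/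
theorem enorm_sq_le_fwdDiff_iter {G : Type*} [AddCommGroup G] (f : G → ℂ) (a x : G) (m : ℕ) :
    ‖f x‖ₑ ^ 2 ≤ ((m + 1) * 4 ^ m : ℕ) *
      (‖(fwdDiff a)^[m] f x‖ₑ ^ 2 + ∑ k ∈ Finset.range m, ‖f (x + (k + 1) • a)‖ₑ ^ 2) := by
  set D : ℂ := (fwdDiff a)^[m] f x with hD
  have hsum := fwdDiff_iter_eq_sum_shift a f m x
  rw [Finset.sum_range_succ'] at hsum
  have h1 : ‖f x‖ ≤ ‖D‖ + ∑ k ∈ Finset.range m, 2 ^ m * ‖f (x + (k + 1) • a)‖ := by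
    have h2 : ((-1 : ℤ) ^ m) • f x = D - ∑ k ∈ Finset.range m,
        ((-1 : ℤ) ^ (m - (k + 1)) * m.choose (k + 1)) • f (x + (k + 1) • a) := by
      rw [hD, hsum]
      simp
    have h3 : ‖f x‖ = ‖((-1 : ℤ) ^ m) • f x‖ := by
      rcases neg_one_pow_eq_or ℤ m with h | h <;> simp [h]
    rw [h3, h2]
    refine (norm_sub_le _ _).trans (add_le_add le_rfl ((norm_sum_le _ _).trans
      (Finset.sum_le_sum fun k _ => ?_)))
    rw [zsmul_eq_mul, norm_mul]
    refine mul_le_mul_of_nonneg_right ?_ (norm_nonneg _)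
    push_cast
    rw [norm_mul, norm_pow, norm_neg, norm_one, one_pow, one_mul, Complex.norm_natCast]
    exact_mod_cast Nat.choose_le_two_pow m (k + 1)
  -- Cauchy–Schwarz for the `m + 1` summands
  let u : ℕ → ℝ := fun k => if k = 0 then ‖D‖ else 2 ^ m * ‖f (x + k • a)‖
  have h4 : ‖f x‖ ^ 2 ≤ ((m + 1) * 4 ^ m : ℕ) *
      (‖D‖ ^ 2 + ∑ k ∈ Finset.range m, ‖f (x + (k + 1) • a)‖ ^ 2) := by
    have h5 : ‖f x‖ ≤ ∑ k ∈ Finset.range (m + 1), u k := by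
      rw [Finset.sum_range_succ']
      simpa [u, add_comm] using h1
    have h6 := sq_sum_le_card_mul_sum_sq (s := Finset.range (m + 1)) (f := u)
    rw [Finset.card_range, Finset.sum_range_succ' (fun k => u k ^ 2)] at h6
    refine (pow_le_pow_left₀ (norm_nonneg _) h5 2).trans (h6.trans ?_)
    have h7 : ∀ k ∈ Finset.range m, u (k + 1) ^ 2 = 4 ^ m * ‖f (x + (k + 1) • a)‖ ^ 2 := by
      intro k _
      simp only [u, Nat.succ_ne_zero, if_false, mul_pow]
      rw [← pow_mul, mul_comm m 2, pow_mul]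
      norm_num
    rw [Finset.sum_congr rfl h7, ← Finset.mul_sum]
    push_cast
    rw [mul_assoc]
    have h8 : ‖D‖ ^ 2 ≤ 4 ^ m * ‖D‖ ^ 2 :=
      le_mul_of_one_le_left (by positivity) (one_le_pow₀ (by norm_num))
    have h9 : u 0 = ‖D‖ := by simp [u]
    rw [h9]
    refine mul_le_mul_of_nonneg_left ?_ (by positivity)
    rw [mul_add]
    linarith
  have h10 := ENNReal.ofReal_le_ofReal h4
  rw [ENNReal.ofReal_mul (by positivity), ENNReal.ofReal_natCast,
    ENNReal.ofReal_add (by positivity) (by positivity),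
    ENNReal.ofReal_sum_of_nonneg (fun _ _ => by positivity)] at h10
  simpa only [ENNReal.ofReal_pow (norm_nonneg _), ofReal_norm] using h10

/-- Among `n` particles there are at least `n - 1` pairs, already those with the first one. -/
theorem sum_le_sum_pairs_add_one {N : ℕ} (u : Fin N → ℝ≥0∞) (hu : ∀ i, u i = 0 ∨ u i = 1) :
    ∑ i, u i ≤ (∑ i, ∑ j ∈ Finset.Ioi i, u i * u j) + 1 := by
  by_cases h : ∃ i, u i = 1
  · obtain ⟨i, hi, hmin⟩ := WellFounded.has_min (wellFounded_lt (α := Fin N)) {i | u i = 1} h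
    have h1 : ∑ j, u j = (∑ j ∈ Finset.Ioi i, u j) + u i := by
      rw [add_comm, Finset.add_sum_Ioi_eq_sum_Ici]
      refine (Finset.sum_subset (Finset.subset_univ _) fun j _ hj => ?_).symm
      exact (hu j).resolve_right fun hj1 =>
        hmin j hj1 (not_le.1 fun hle => hj (Finset.mem_Ici.2 hle))
    have hi : u i = 1 := hi
    rw [h1, hi]
    refine add_le_add ?_ le_rfl
    calc ∑ j ∈ Finset.Ioi i, u j = ∑ j ∈ Finset.Ioi i, u i * u j := by simp [hi]
      _ ≤ _ := Finset.single_le_sum (f := fun i => ∑ j ∈ Finset.Ioi i, u i * u j)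
          (fun _ _ => zero_le) (Finset.mem_univ i)
  · push Not at h
    have h0 : ∀ i, u i = 0 := fun i => (hu i).resolve_right (h i)
    simp [h0]

theorem lintegral_ball_comp_add_nsmul_le {d : ℕ} {g : EuclideanSpace ℝ (Fin d) → ℝ≥0∞}
    (hg : Measurable g) (x : EuclideanSpace ℝ (Fin d)) {k m : ℕ} (hk : k < m) (l : ℝ) :
    ∫⁻ h in Metric.ball (0 : EuclideanSpace ℝ (Fin d)) l, g (x + (k + 1) • h) ≤
      ∫⁻ z in Metric.ball x (m * l), g z := by
  have hc : ((k + 1 : ℕ) : ℝ) ≠ 0 := by positivity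
  set G : EuclideanSpace ℝ (Fin d) → ℝ≥0∞ := (Metric.ball x (m * l)).indicator g with hGdef
  have hG : Measurable G := hg.indicator Metric.isOpen_ball.measurableSet
  calc ∫⁻ h in Metric.ball (0 : EuclideanSpace ℝ (Fin d)) l, g (x + (k + 1) • h)
      ≤ ∫⁻ h in Metric.ball (0 : EuclideanSpace ℝ (Fin d)) l, G (x + ((k + 1 : ℕ) : ℝ) • h) := by
        refine setLIntegral_mono' Metric.isOpen_ball.measurableSet fun h hh => ?_
        rw [Nat.cast_smul_eq_nsmul, hGdef, Set.indicator_of_mem]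
        rw [mem_ball_zero_iff] at hh
        rw [mem_ball_iff_norm, add_sub_cancel_left, ← Nat.cast_smul_eq_nsmul ℝ, norm_smul,
          Real.norm_natCast]
        have : ((k + 1 : ℕ) : ℝ) ≤ m := by exact_mod_cast hk
        exact (mul_le_mul_of_nonneg_right this (norm_nonneg _)).trans_lt
          (mul_lt_mul_of_pos_left hh (by linarith [show (0:ℝ) < ((k + 1 : ℕ) : ℝ) by positivity]))
    _ ≤ ∫⁻ h, G (x + ((k + 1 : ℕ) : ℝ) • h) := setLIntegral_le_lintegral _ _
    _ = ENNReal.ofReal |(((k + 1 : ℕ) : ℝ) ^ d)⁻¹| * ∫⁻ h, G (x + h) := by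
        have h := lintegral_map (μ := (volume : Measure (EuclideanSpace ℝ (Fin d))))
          (f := fun h => G (x + h)) (g := fun h => ((k + 1 : ℕ) : ℝ) • h) (by fun_prop)
          (by fun_prop)
        rw [← h, Measure.map_addHaar_smul _ hc, lintegral_smul_measure,
          finrank_euclideanSpace_fin, smul_eq_mul]
    _ ≤ 1 * ∫⁻ h, G (x + h) := by
        refine mul_le_mul_left ?_ _
        rw [ENNReal.ofReal_le_one, abs_of_nonneg (by positivity)]
        refine inv_le_one_of_one_le₀ (one_le_pow₀ ?_)
        exact_mod_cast Nat.le_add_left 1 k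
    _ = ∫⁻ z in Metric.ball x (m * l), g z := by
        rw [one_mul, lintegral_add_left_eq_self, hGdef,
          lintegral_indicator Metric.isOpen_ball.measurableSet]

/-- The dichotomy at a point. Here `ρ` is the density at the point, `D h` the density of the
finite difference with step `h`, and `P r` the expected number of pairs of particles in the ball
of radius `r`. At the scale `l` with `l ^ d` comparable to `1 / ρ`, either a pair is expected, or
the finite differences carry the density. -/
theorem exists_rpow_le_lintegral_add_lintegral {d : ℕ} (hd : 1 ≤ d) {s : ℝ} (hs : 0 < s) {m A : ℕ}
    (hm : 1 ≤ m) (hA : 1 ≤ A) :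
    ∃ C : ℝ≥0∞, C ≠ ∞ ∧ ∀ (ρ : ℝ≥0∞) (D : EuclideanSpace ℝ (Fin d) → ℝ≥0∞) (P : ℝ → ℝ≥0∞),
      ρ ≠ ∞ → D 0 = 0 → Monotone P →
      (∀ l : ℝ, 0 < l → volume (Metric.ball (0 : EuclideanSpace ℝ (Fin d)) l) * ρ ≤
        A * ((∫⁻ h in Metric.ball 0 l, D h) + m * (P (m * l) + 1))) →
      ρ ^ (1 + 2 * s / (d : ℝ)) ≤
        C * ((∫⁻ h, ENNReal.ofReal (‖h‖ ^ (-(d + 2 * s))) * D h) +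
          ∫⁻ r in Set.Ioi (0 : ℝ), ENNReal.ofReal (r ^ (-(1 + d + 2 * s))) * P r) := by
  have : Nonempty (Fin d) := ⟨⟨0, hd⟩⟩
  have hd0 : (0 : ℝ) < d := by exact_mod_cast hd
  have hmr : (1 : ℝ) ≤ m := by exact_mod_cast hm
  have hAr : (1 : ℝ) ≤ A := by exact_mod_cast hA
  set V : ℝ := volume.real (Metric.ball (0 : EuclideanSpace ℝ (Fin d)) 1)
  have hV : 0 < V :=
    ENNReal.toReal_pos (Metric.measure_ball_pos _ _ one_pos).ne' measure_ball_lt_top.ne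
  set q : ℝ := 1 + 2 * s / d
  set b : ℝ := 4 * A * m / V
  have hb : 0 < b := by positivity
  -- the radii in `[m * l, 2 * m * l]` contribute at least `c`, in units of `l ^ (-d - 2 * s)`
  set c : ℝ := m * (2 * m) ^ (-(1 + d + 2 * s))
  have hc : 0 < c := by positivity
  have hc1 : c ≤ 1 := by
    have h2 : c ≤ (2 * m) * (2 * m) ^ (-(1 + d + 2 * s)) :=
      mul_le_mul_of_nonneg_right (by linarith) (by positivity)
    have h3 : (2 * m : ℝ) * (2 * m) ^ (-(1 + d + 2 * s)) = (2 * m) ^ (-(d + 2 * s)) := by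
      rw [← Real.rpow_one_add' (by positivity) (by linarith)]
      congr 1
      ring
    rw [h3] at h2
    exact h2.trans (Real.rpow_le_one_of_one_le_of_nonpos (by linarith) (by linarith))
  refine ⟨ENNReal.ofReal (b ^ q / c), ENNReal.ofReal_ne_top, fun ρ D P hρ hD hP hmain => ?_⟩
  have hq : 0 < q := by positivity
  obtain rfl | hρ0 := eq_or_ne ρ 0
  · rw [ENNReal.zero_rpow_of_pos hq]
    exact zero_le
  set a : ℝ := ρ.toReal
  have ha : 0 < a := ENNReal.toReal_pos hρ0 hρ
  have hρa : ρ = ENNReal.ofReal a := (ENNReal.ofReal_toReal hρ).symm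
  -- the scale at which the ball has measure times density `4 * A * m`, twice what the term with
  -- `P` contributes when `P ≤ 1`
  set l : ℝ := (b / a) ^ (1 / (d : ℝ))
  have hl : 0 < l := by positivity
  have hld : l ^ d = b / a := by
    rw [← Real.rpow_natCast, ← Real.rpow_mul (by positivity), one_div_mul_cancel hd0.ne',
      Real.rpow_one]
  have hlq : a ^ q = b ^ q * l ^ (-(d + 2 * s)) := by
    have h1 : l ^ (-(d + 2 * s)) = (b / a) ^ (-q) := by
      rw [← Real.rpow_mul (by positivity)]
      congr 1
      simp only [q]
      field_simp
    rw [h1, Real.rpow_neg (by positivity), Real.div_rpow hb.le ha.le]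
    field_simp
  suffices h : ENNReal.ofReal (c * l ^ (-(d + 2 * s))) ≤
      (∫⁻ h, ENNReal.ofReal (‖h‖ ^ (-(d + 2 * s))) * D h) +
        ∫⁻ r in Set.Ioi (0 : ℝ), ENNReal.ofReal (r ^ (-(1 + d + 2 * s))) * P r by
    refine le_trans (le_of_eq ?_) (mul_le_mul_right h _)
    rw [hρa, ENNReal.ofReal_rpow_of_pos ha, ← ENNReal.ofReal_mul (by positivity), hlq]
    congr 1
    field_simp
  rcases le_or_gt 1 (P (m * l)) with hP1 | hP1
  · refine le_trans ?_ le_add_self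
    calc ENNReal.ofReal (c * l ^ (-(d + 2 * s)))
        = ∫⁻ r in Set.Ioc (m * l) (2 * (m * l)),
            ENNReal.ofReal ((2 * (m * l)) ^ (-(1 + d + 2 * s))) := by
          rw [setLIntegral_const, Real.volume_Ioc, ← ENNReal.ofReal_mul (by positivity)]
          congr 1
          simp only [c]
          rw [← mul_assoc, Real.mul_rpow (by positivity) hl.le,
            show -((d : ℝ) + 2 * s) = 1 + -(1 + d + 2 * s) by ring, Real.rpow_add hl, Real.rpow_one]
          ring
      _ ≤ ∫⁻ r in Set.Ioc (m * l) (2 * (m * l)),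
            ENNReal.ofReal (r ^ (-(1 + d + 2 * s))) * P r := by
          refine setLIntegral_mono' measurableSet_Ioc fun r hr => ?_
          have hr0 : 0 < r := lt_trans (by positivity) hr.1
          refine le_trans ?_ (mul_le_mul_right (hP1.trans (hP hr.1.le)) _)
          rw [mul_one]
          exact ENNReal.ofReal_le_ofReal
            (Real.rpow_le_rpow_of_nonpos hr0 hr.2 (by linarith))
      _ ≤ _ := lintegral_mono_set fun r hr => lt_trans (show 0 < m * l by positivity) hr.1
  · refine le_trans ?_ le_self_add
    have h1 : (1 : ℝ≥0∞) ≤ ∫⁻ h in Metric.ball 0 l, D h := by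
      have h2 := hmain l hl
      have h3 : volume (Metric.ball (0 : EuclideanSpace ℝ (Fin d)) l) * ρ =
          A * (2 * m + 2 * m) := by
        rw [Measure.addHaar_ball _ _ hl.le, finrank_euclideanSpace_fin, hld, hρa,
          ← ENNReal.ofReal_toReal (measure_ball_lt_top (μ := volume)
            (x := (0 : EuclideanSpace ℝ (Fin d))) (r := 1)).ne,
          ← ENNReal.ofReal_mul (by positivity), ← ENNReal.ofReal_mul (by positivity)]
        change ENNReal.ofReal (b / a * V * a) = _
        have h4 : b / a * V * a = ((A * (2 * m + 2 * m) : ℕ) : ℝ) := by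
          simp only [b]
          push_cast
          field_simp
          ring
        rw [h4, ENNReal.ofReal_natCast]
        push_cast
        rfl
      rw [h3, ENNReal.mul_le_mul_iff_right (by positivity) (ENNReal.natCast_ne_top A)] at h2
      have h5 : (m : ℝ≥0∞) * (P (m * l) + 1) ≤ 2 * m := by
        rw [mul_comm]
        refine mul_le_mul_left ?_ _
        calc P (m * l) + 1 ≤ 1 + 1 := add_le_add hP1.le le_rfl
          _ = 2 := one_add_one_eq_two
      have h6 := h2.trans (add_le_add le_rfl h5)
      rw [ENNReal.add_le_add_iff_right (by finiteness)] at h6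
      refine le_trans ?_ h6
      exact_mod_cast (by omega : 1 ≤ 2 * m)
    calc ENNReal.ofReal (c * l ^ (-(d + 2 * s)))
        ≤ ENNReal.ofReal (l ^ (-(d + 2 * s))) * 1 := by
          rw [mul_one]
          exact ENNReal.ofReal_le_ofReal (mul_le_of_le_one_left (by positivity) hc1)
      _ ≤ ENNReal.ofReal (l ^ (-(d + 2 * s))) * ∫⁻ h in Metric.ball 0 l, D h :=
          mul_le_mul_right h1 _
      _ ≤ ∫⁻ h in Metric.ball 0 l, ENNReal.ofReal (l ^ (-(d + 2 * s))) * D h :=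
          lintegral_const_mul_le _ _
      _ ≤ ∫⁻ h in Metric.ball 0 l, ENNReal.ofReal (‖h‖ ^ (-(d + 2 * s))) * D h := by
          refine setLIntegral_mono' Metric.isOpen_ball.measurableSet fun h hh => ?_
          -- at `h = 0` the weight is the junk value `0`, but `D` vanishes there
          obtain rfl | h0 := eq_or_ne h 0
          · simp [hD]
          · rw [mem_ball_zero_iff] at hh
            exact mul_le_mul_left (ENNReal.ofReal_le_ofReal (Real.rpow_le_rpow_of_nonpos
              (norm_pos_iff.2 h0) hh.le (by linarith))) _
      _ ≤ _ := setLIntegral_le_lintegral _ _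

end Pointwise

/-! ### The two error terms -/

section Energy

variable {d N : ℕ}

/-- The density at `x` of the `m`-th finite differences of `Ψ` with step `h` in each particle. -/
noncomputable def fwdDiffDensity (m : ℕ) (Ψ : WaveFunction d N)
    (h x : EuclideanSpace ℝ (Fin d)) : ℝ≥0∞ :=
  ∑ j : Fin N,
    particleDensity j (fun X => ‖(fwdDiff (insertParticle j h 0))^[m] (⇑Ψ) X‖ₑ ^ 2) x

/-- The expected number of pairs of particles in the ball of radius `r` about `x`. -/
noncomputable def expectedPairs (Ψ : WaveFunction d N) (x : EuclideanSpace ℝ (Fin d)) (r : ℝ) :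
    ℝ≥0∞ :=
  ∫⁻ X : ConfigSpace d N, (∑ i : Fin N, ∑ j ∈ Finset.Ioi i,
    (Metric.ball x r).indicator 1 (particle i X) * (Metric.ball x r).indicator 1 (particle j X)) *
      ‖Ψ X‖ₑ ^ 2

theorem measurable_enorm_sq (Ψ : WaveFunction d N) :
    Measurable fun X => ‖Ψ X‖ₑ ^ 2 :=
  (Lp.stronglyMeasurable Ψ).measurable.enorm.pow_const 2

theorem oneBodyDensity_eq_sum (Ψ : WaveFunction d N) (x : EuclideanSpace ℝ (Fin d)) :
    oneBodyDensity Ψ x = ∑ j : Fin N, particleDensity j (fun X => ‖Ψ X‖ₑ ^ 2) x :=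
  rfl

theorem measurable_oneBodyDensity (Ψ : WaveFunction d N) : Measurable (oneBodyDensity Ψ) :=
  Finset.measurable_sum _ fun j _ => measurable_particleDensity j (measurable_enorm_sq Ψ)

theorem Measurable.insertParticle_zero {α : Type*} [MeasurableSpace α]
    {u : α → EuclideanSpace ℝ (Fin d)} (hu : Measurable u) (j : Fin N) :
    Measurable fun a => insertParticle j (u a) 0 :=
  (measurable_insertParticle j).comp (hu.prodMk measurable_const)

theorem Measurable.enorm_fwdDiff_iter_sq {α : Type*} [MeasurableSpace α]
    {u : α → EuclideanSpace ℝ (Fin d)} {v : α → ConfigSpace d N} (hu : Measurable u)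
    (hv : Measurable v) (m : ℕ) (Ψ : WaveFunction d N) (j : Fin N) :
    Measurable fun a => ‖(fwdDiff (insertParticle j (u a) 0))^[m] (⇑Ψ) (v a)‖ₑ ^ 2 := by
  simp only [fwdDiff_iter_eq_sum_shift, nsmul_insertParticle_zero, zsmul_eq_mul]
  refine (Measurable.enorm (Finset.measurable_sum _ fun k _ =>
    measurable_const.mul ?_)).pow_const 2
  have hk : Measurable fun a => k • u a := by
    simp only [← Nat.cast_smul_eq_nsmul ℝ]
    exact hu.const_smul (k : ℝ)
  exact (Lp.stronglyMeasurable Ψ).measurable.comp (hv.add (hk.insertParticle_zero j))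

theorem Measurable.fwdDiffDensity {α : Type*} [MeasurableSpace α]
    {u v : α → EuclideanSpace ℝ (Fin d)} (hu : Measurable u) (hv : Measurable v) (m : ℕ)
    (Ψ : WaveFunction d N) : Measurable fun a => fwdDiffDensity m Ψ (u a) (v a) := by
  refine Finset.measurable_sum _ fun j _ => ?_
  let f : EuclideanSpace ℝ (Fin d) → ConfigSpace d N → ℝ≥0∞ :=
    fun h X => ‖(fwdDiff (insertParticle j h 0))^[m] (⇑Ψ) X‖ₑ ^ 2
  have hf : Measurable fun q : EuclideanSpace ℝ (Fin d) × ConfigSpace d N => f q.1 q.2 :=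
    measurable_fst.enorm_fwdDiff_iter_sq measurable_snd m Ψ j
  have h := (measurable_particleDensity_prod j hf).comp (hu.prodMk hv)
  exact h

theorem fwdDiffDensity_zero {m : ℕ} (hm : m ≠ 0) (Ψ : WaveFunction d N)
    (x : EuclideanSpace ℝ (Fin d)) : fwdDiffDensity m Ψ 0 x = 0 := by
  obtain ⟨m, rfl⟩ := Nat.exists_eq_succ_of_ne_zero hm
  refine Finset.sum_eq_zero fun j _ => ?_
  have h0 : insertParticle j (0 : EuclideanSpace ℝ (Fin d)) 0 = 0 := by
    ext p
    simp [insertParticle]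
  have h1 : ∀ X, (fwdDiff (insertParticle j (0 : EuclideanSpace ℝ (Fin d)) 0))^[m + 1] (⇑Ψ) X
      = 0 := by
    intro X
    rw [Function.iterate_succ_apply', fwdDiff, h0, add_zero, sub_self]
  simp [particleDensity, h1]

theorem oneBodyDensity_le (m : ℕ) (Ψ : WaveFunction d N) (h x : EuclideanSpace ℝ (Fin d)) :
    oneBodyDensity Ψ x ≤ ((m + 1) * 4 ^ m : ℕ) *
      (fwdDiffDensity m Ψ h x + ∑ k ∈ Finset.range m, oneBodyDensity Ψ (x + (k + 1) • h)) := by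
  simp only [oneBodyDensity_eq_sum, fwdDiffDensity]
  rw [Finset.sum_comm, ← Finset.sum_add_distrib, Finset.mul_sum]
  refine Finset.sum_le_sum fun j _ => ?_
  have hins : Measurable fun y : {i : Fin N // i ≠ j} → EuclideanSpace ℝ (Fin d) =>
      insertParticle j x y :=
    (measurable_insertParticle j).comp (measurable_const.prodMk measurable_id)
  have hm1 : Measurable fun y : {i : Fin N // i ≠ j} → EuclideanSpace ℝ (Fin d) =>
      ‖(fwdDiff (insertParticle j h 0))^[m] (⇑Ψ) (insertParticle j x y)‖ₑ ^ 2 :=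
    measurable_const.enorm_fwdDiff_iter_sq hins m Ψ j
  have hm2 : ∀ k ∈ Finset.range m, Measurable
      fun y : {i : Fin N // i ≠ j} → EuclideanSpace ℝ (Fin d) =>
      ‖Ψ (insertParticle j x y + insertParticle j ((k + 1) • h) 0)‖ₑ ^ 2 := fun k _ =>
    (measurable_enorm_sq Ψ).comp (hins.add_const _)
  simp only [particleDensity_add]
  simp only [particleDensity]
  rw [← lintegral_finsetSum _ hm2, ← lintegral_add_left hm1,
    ← lintegral_const_mul' _ _ (ENNReal.natCast_ne_top _)]
  refine lintegral_mono fun y => ?_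
  simp only [← nsmul_insertParticle_zero]
  exact enorm_sq_le_fwdDiff_iter _ _ _ _

theorem lintegral_mul_oneBodyDensity (Ψ : WaveFunction d N)
    {g : EuclideanSpace ℝ (Fin d) → ℝ≥0∞} (hg : Measurable g) :
    ∫⁻ x, g x * oneBodyDensity Ψ x =
      ∫⁻ X : ConfigSpace d N, (∑ j, g (particle j X)) * ‖Ψ X‖ₑ ^ 2 := by
  simp only [oneBodyDensity_eq_sum, Finset.mul_sum, Finset.sum_mul]
  have h1 : ∀ j ∈ Finset.univ, Measurable fun x =>
      g x * particleDensity j (fun X : ConfigSpace d N => ‖Ψ X‖ₑ ^ 2) x := fun j _ =>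
    hg.mul (measurable_particleDensity j (measurable_enorm_sq Ψ))
  have h2 : ∀ j ∈ Finset.univ, Measurable fun X : ConfigSpace d N =>
      g (particle j X) * ‖Ψ X‖ₑ ^ 2 := fun j _ =>
    (hg.comp (measurable_particle j)).mul (measurable_enorm_sq Ψ)
  rw [lintegral_finsetSum _ h1, lintegral_finsetSum _ h2]
  exact Finset.sum_congr rfl fun j _ => lintegral_mul_particleDensity j hg (measurable_enorm_sq Ψ)

theorem lintegral_oneBodyDensity {Ψ : WaveFunction d N} (hΨ : ‖Ψ‖ = 1) :
    ∫⁻ x, oneBodyDensity Ψ x = N := by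
  have h := lintegral_mul_oneBodyDensity Ψ (g := fun _ => 1) measurable_const
  simp only [one_mul, Finset.sum_const, Finset.card_univ, Fintype.card_fin, nsmul_eq_mul,
    mul_one] at h
  rw [h, lintegral_const_mul _ (measurable_enorm_sq Ψ), lintegral_enorm_sq_eq, ← ofReal_norm, hΨ]
  simp

theorem expectedPairs_mono (Ψ : WaveFunction d N) (x : EuclideanSpace ℝ (Fin d)) :
    Monotone (expectedPairs Ψ x) := by
  intro r t hrt
  refine lintegral_mono fun X => mul_le_mul_left (Finset.sum_le_sum fun i _ =>
    Finset.sum_le_sum fun j _ => ?_) _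
  exact mul_le_mul'
    (Set.indicator_le_indicator_of_subset (Metric.ball_subset_ball hrt) (fun _ => zero_le) _)
    (Set.indicator_le_indicator_of_subset (Metric.ball_subset_ball hrt) (fun _ => zero_le) _)

/-- Local exclusion: an expected particle number above one forces pairs. -/
theorem setLIntegral_ball_oneBodyDensity_le {Ψ : WaveFunction d N} (hΨ : ‖Ψ‖ = 1)
    (x : EuclideanSpace ℝ (Fin d)) (r : ℝ) :
    ∫⁻ z in Metric.ball x r, oneBodyDensity Ψ z ≤ expectedPairs Ψ x r + 1 := by
  have hB : MeasurableSet (Metric.ball x r) := Metric.isOpen_ball.measurableSet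
  have h1 : Measurable ((Metric.ball x r).indicator (1 : EuclideanSpace ℝ (Fin d) → ℝ≥0∞)) :=
    measurable_one.indicator hB
  have h2 : ∫⁻ X : ConfigSpace d N, ‖Ψ X‖ₑ ^ 2 = 1 := by
    rw [lintegral_enorm_sq_eq, ← ofReal_norm, hΨ]
    simp
  calc ∫⁻ z in Metric.ball x r, oneBodyDensity Ψ z
      = ∫⁻ z, (Metric.ball x r).indicator 1 z * oneBodyDensity Ψ z := by
        rw [← lintegral_indicator hB]
        refine lintegral_congr fun z => ?_
        by_cases hz : z ∈ Metric.ball x r <;> simp [hz]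
    _ = ∫⁻ X : ConfigSpace d N,
          (∑ j, (Metric.ball x r).indicator 1 (particle j X)) * ‖Ψ X‖ₑ ^ 2 :=
        lintegral_mul_oneBodyDensity Ψ h1
    _ ≤ ∫⁻ X : ConfigSpace d N, ((∑ i : Fin N, ∑ j ∈ Finset.Ioi i,
          (Metric.ball x r).indicator 1 (particle i X) *
            (Metric.ball x r).indicator 1 (particle j X)) * ‖Ψ X‖ₑ ^ 2 + ‖Ψ X‖ₑ ^ 2) := by
        refine lintegral_mono fun X => ?_
        refine (mul_le_mul_left (sum_le_sum_pairs_add_one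
          (fun j => (Metric.ball x r).indicator 1 (particle j X)) fun j => ?_) _).trans_eq ?_
        · by_cases hj : particle j X ∈ Metric.ball x r <;> simp [hj]
        · rw [add_mul, one_mul]
    _ = expectedPairs Ψ x r + 1 := by
        rw [lintegral_add_right _ (measurable_enorm_sq Ψ), h2]
        rfl

/-- The average of `oneBodyDensity_le` over all steps `h` in a ball of radius `l`; the nodes
`x + (k + 1) • h` stay in the ball of radius `m * l` about `x`. -/
theorem volume_ball_mul_oneBodyDensity_le (m : ℕ) {Ψ : WaveFunction d N} (hΨ : ‖Ψ‖ = 1)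
    (x : EuclideanSpace ℝ (Fin d)) (l : ℝ) :
    volume (Metric.ball (0 : EuclideanSpace ℝ (Fin d)) l) * oneBodyDensity Ψ x ≤
      ((m + 1) * 4 ^ m : ℕ) * ((∫⁻ h in Metric.ball 0 l, fwdDiffDensity m Ψ h x) +
        m * (expectedPairs Ψ x (m * l) + 1)) := by
  have hρ := measurable_oneBodyDensity Ψ
  have hD : Measurable fun h => fwdDiffDensity m Ψ h x :=
    measurable_id.fwdDiffDensity measurable_const m Ψ
  have hsm : ∀ k : ℕ, Measurable fun h : EuclideanSpace ℝ (Fin d) =>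
      oneBodyDensity Ψ (x + (k + 1) • h) := fun k => by
    have hk : Measurable fun h : EuclideanSpace ℝ (Fin d) => x + (k + 1) • h := by
      simp only [← Nat.cast_smul_eq_nsmul ℝ]
      exact (measurable_id.const_smul ((k + 1 : ℕ) : ℝ)).const_add x
    have h := hρ.comp hk
    exact h
  calc volume (Metric.ball (0 : EuclideanSpace ℝ (Fin d)) l) * oneBodyDensity Ψ x
      = ∫⁻ _ in Metric.ball (0 : EuclideanSpace ℝ (Fin d)) l, oneBodyDensity Ψ x := by
        rw [setLIntegral_const, mul_comm]
    _ ≤ ∫⁻ h in Metric.ball (0 : EuclideanSpace ℝ (Fin d)) l, ((m + 1) * 4 ^ m : ℕ) *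
          (fwdDiffDensity m Ψ h x + ∑ k ∈ Finset.range m, oneBodyDensity Ψ (x + (k + 1) • h)) :=
        lintegral_mono fun h => oneBodyDensity_le m Ψ h x
    _ = ((m + 1) * 4 ^ m : ℕ) * ((∫⁻ h in Metric.ball 0 l, fwdDiffDensity m Ψ h x) +
          ∑ k ∈ Finset.range m, ∫⁻ h in Metric.ball (0 : EuclideanSpace ℝ (Fin d)) l,
            oneBodyDensity Ψ (x + (k + 1) • h)) := by
        rw [lintegral_const_mul' _ _ (ENNReal.natCast_ne_top _),
          lintegral_add_left hD, lintegral_finsetSum _ fun k _ => hsm k]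
    _ ≤ _ := by
        refine mul_le_mul_right (add_le_add le_rfl ?_) _
        refine (Finset.sum_le_card_nsmul _ _ (expectedPairs Ψ x (m * l) + 1)
          fun k hk => ?_).trans_eq (by rw [Finset.card_range, nsmul_eq_mul])
        exact (lintegral_ball_comp_add_nsmul_le hρ x (Finset.mem_range.1 hk) l).trans
          (setLIntegral_ball_oneBodyDensity_le hΨ x _)

/-- The Gagliardo form of order `m > s`, summed over the particles, is bounded by the kinetic
energy. -/
theorem exists_lintegral_fwdDiffDensity_le (hd : 1 ≤ d) {s : ℝ} (hs : 0 < s) {m : ℕ}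
    (hm : s < m) :
    ∃ C : ℝ≥0∞, C ≠ ∞ ∧ ∀ (N : ℕ) (Ψ : WaveFunction d N),
      ∫⁻ x, ∫⁻ h, ENNReal.ofReal (‖h‖ ^ (-(d + 2 * s))) * fwdDiffDensity m Ψ h x ≤
        C * ∑ i : Fin N, kineticForm s i Ψ := by
  obtain ⟨C, hC, hCle⟩ := exists_lintegral_fourierChar_sub_one_le hd hs hm
  refine ⟨C, hC, fun N Ψ => ?_⟩
  have hw : Measurable fun h : EuclideanSpace ℝ (Fin d) =>
    ENNReal.ofReal (‖h‖ ^ (-(d + 2 * s))) := by fun_prop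
  have hΨm := (measurable_enorm_sq (𝓕 Ψ : WaveFunction d N))
  calc ∫⁻ x, ∫⁻ h, ENNReal.ofReal (‖h‖ ^ (-(d + 2 * s))) * fwdDiffDensity m Ψ h x
      = ∫⁻ h, ∫⁻ x, ENNReal.ofReal (‖h‖ ^ (-(d + 2 * s))) * fwdDiffDensity m Ψ h x :=
        lintegral_lintegral_swap ((hw.comp measurable_snd).mul
          (measurable_snd.fwdDiffDensity measurable_fst m Ψ)).aemeasurable
    _ = ∫⁻ h, ∑ j : Fin N, ∫⁻ ξ : ConfigSpace d N, ENNReal.ofReal (‖h‖ ^ (-(d + 2 * s))) *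
          ‖((Real.fourierChar (inner ℝ h (particle j ξ)) : Circle) : ℂ) - 1‖ₑ ^ (2 * m) *
            ‖(𝓕 Ψ : WaveFunction d N) ξ‖ₑ ^ 2 := by
        refine lintegral_congr fun h => ?_
        have hjm : ∀ j : Fin N, Measurable fun X : ConfigSpace d N =>
            ‖(fwdDiff (insertParticle j h 0))^[m] (⇑Ψ) X‖ₑ ^ 2 := fun j =>
          measurable_const.enorm_fwdDiff_iter_sq measurable_id m Ψ j
        rw [lintegral_const_mul' _ _ ENNReal.ofReal_ne_top]
        simp only [fwdDiffDensity]
        rw [lintegral_finsetSum _ fun j _ => measurable_particleDensity j (hjm j),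
          Finset.mul_sum]
        refine Finset.sum_congr rfl fun j _ => ?_
        rw [lintegral_particleDensity j (hjm j), lintegral_enorm_fwdDiff_iter_sq]
        simp only [inner_insertParticle_zero, mul_assoc]
        rw [lintegral_const_mul' _ _ ENNReal.ofReal_ne_top]
    _ = ∑ j : Fin N, ∫⁻ ξ : ConfigSpace d N, (∫⁻ h, ENNReal.ofReal (‖h‖ ^ (-(d + 2 * s))) *
          ‖((Real.fourierChar (inner ℝ h (particle j ξ)) : Circle) : ℂ) - 1‖ₑ ^ (2 * m)) *
            ‖(𝓕 Ψ : WaveFunction d N) ξ‖ₑ ^ 2 := by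
        have hchar : ∀ j : Fin N, Measurable fun p : EuclideanSpace ℝ (Fin d) × ConfigSpace d N =>
            ENNReal.ofReal (‖p.1‖ ^ (-(d + 2 * s))) *
            ‖((Real.fourierChar (inner ℝ p.1 (particle j p.2)) : Circle) : ℂ) - 1‖ₑ ^ (2 * m) := by
          intro j
          have hc : Continuous fun t : ℝ => ‖((Real.fourierChar t : Circle) : ℂ) - 1‖ₑ := by
            fun_prop
          refine (hw.comp measurable_fst).mul (Measurable.pow_const (hc.measurable.comp ?_) _)
          exact measurable_fst.inner ((measurable_particle j).comp measurable_snd)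
        have hall : ∀ j : Fin N, Measurable fun p : EuclideanSpace ℝ (Fin d) × ConfigSpace d N =>
            ENNReal.ofReal (‖p.1‖ ^ (-(d + 2 * s))) *
            ‖((Real.fourierChar (inner ℝ p.1 (particle j p.2)) : Circle) : ℂ) - 1‖ₑ ^ (2 * m) *
            ‖(𝓕 Ψ : WaveFunction d N) p.2‖ₑ ^ 2 := fun j =>
          (hchar j).mul (hΨm.comp measurable_snd)
        rw [lintegral_finsetSum _ fun j _ => (hall j).lintegral_prod_right']
        refine Finset.sum_congr rfl fun j _ => ?_
        rw [lintegral_lintegral_swap (hall j).aemeasurable]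
        refine lintegral_congr fun ξ => ?_
        have hξ : Measurable fun h : EuclideanSpace ℝ (Fin d) =>
            ENNReal.ofReal (‖h‖ ^ (-(d + 2 * s))) *
            ‖((Real.fourierChar (inner ℝ h (particle j ξ)) : Circle) : ℂ) - 1‖ₑ ^ (2 * m) :=
          (hchar j).of_uncurry_right (f := fun h ξ => ENNReal.ofReal (‖h‖ ^ (-(d + 2 * s))) *
            ‖((Real.fourierChar (inner ℝ h (particle j ξ)) : Circle) : ℂ) - 1‖ₑ ^ (2 * m))
        exact lintegral_mul_const (‖(𝓕 Ψ : WaveFunction d N) ξ‖ₑ ^ 2) hξ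
    _ ≤ ∑ j : Fin N, ∫⁻ ξ : ConfigSpace d N, C *
          (ENNReal.ofReal ((2 * Real.pi * ‖particle j ξ‖) ^ (2 * s)) *
            ‖(𝓕 Ψ : WaveFunction d N) ξ‖ₑ ^ 2) := by
        refine Finset.sum_le_sum fun j _ => lintegral_mono fun ξ => ?_
        rw [← mul_assoc]
        exact mul_le_mul_left (hCle _) _
    _ = C * ∑ i : Fin N, kineticForm s i Ψ := by
        rw [Finset.mul_sum]
        exact Finset.sum_congr rfl fun j _ => lintegral_const_mul' _ _ hC

theorem Measurable.indicator_ball_one {α : Type*} [MeasurableSpace α]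
    {u v : α → EuclideanSpace ℝ (Fin d)} {r : α → ℝ} (hu : Measurable u) (hr : Measurable r)
    (hv : Measurable v) :
    Measurable fun a =>
      (Metric.ball (u a) (r a)).indicator (1 : EuclideanSpace ℝ (Fin d) → ℝ≥0∞) (v a) := by
  classical
  simp only [Set.indicator_apply, Pi.one_apply, Metric.mem_ball]
  exact Measurable.ite (measurableSet_lt (hv.dist hu) hr) measurable_const measurable_const

/-- The expected pairs in balls, integrated over all centres and radii, are bounded by the
interaction energy. -/
theorem exists_lintegral_expectedPairs_le (hd : 1 ≤ d) {s : ℝ} (hs : 0 < s) :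
    ∃ C : ℝ≥0∞, C ≠ ∞ ∧ ∀ (N : ℕ) (Ψ : WaveFunction d N),
      ∫⁻ x, ∫⁻ r in Set.Ioi (0 : ℝ),
          ENNReal.ofReal (r ^ (-(1 + d + 2 * s))) * expectedPairs Ψ x r ≤
        C * interactionForm s Ψ := by
  obtain ⟨C, hC, hCle⟩ := exists_lintegral_volume_ball_inter_ball_le hd hs
  refine ⟨C, hC, fun N Ψ => ?_⟩
  set w : ℝ → ℝ≥0∞ := fun r => ENNReal.ofReal (r ^ (-(1 + d + 2 * s)))
  have hw : Measurable w := by fun_prop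
  let ν : Measure (EuclideanSpace ℝ (Fin d) × ℝ) :=
    (volume : Measure (EuclideanSpace ℝ (Fin d))).prod (volume.restrict (Set.Ioi 0))
  let F : Fin N → Fin N → (EuclideanSpace ℝ (Fin d) × ℝ) → ConfigSpace d N → ℝ≥0∞ :=
    fun i j p X => w p.2 * ((Metric.ball p.1 p.2).indicator 1 (particle i X) *
      (Metric.ball p.1 p.2).indicator 1 (particle j X))
  have hB : ∀ i : Fin N, Measurable fun q : (EuclideanSpace ℝ (Fin d) × ℝ) × ConfigSpace d N =>
      (Metric.ball q.1.1 q.1.2).indicator (1 : EuclideanSpace ℝ (Fin d) → ℝ≥0∞)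
        (particle i q.2) := fun i =>
    measurable_fst.fst.indicator_ball_one measurable_fst.snd
      ((measurable_particle i).comp measurable_snd)
  have hF : ∀ i j, Measurable fun q : (EuclideanSpace ℝ (Fin d) × ℝ) × ConfigSpace d N =>
      F i j q.1 q.2 := fun i j => (hw.comp measurable_fst.snd).mul ((hB i).mul (hB j))
  have hG : Measurable fun q : (EuclideanSpace ℝ (Fin d) × ℝ) × ConfigSpace d N =>
      (∑ i : Fin N, ∑ j ∈ Finset.Ioi i, F i j q.1 q.2) * ‖Ψ q.2‖ₑ ^ 2 :=
    (Finset.measurable_sum _ fun i _ => Finset.measurable_sum _ fun j _ => hF i j).mul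
      ((measurable_enorm_sq Ψ).comp measurable_snd)
  have hpt : ∀ p : EuclideanSpace ℝ (Fin d) × ℝ, w p.2 * expectedPairs Ψ p.1 p.2 =
      ∫⁻ X, (∑ i : Fin N, ∑ j ∈ Finset.Ioi i, F i j p X) * ‖Ψ X‖ₑ ^ 2 := by
    intro p
    rw [expectedPairs, ← lintegral_const_mul' _ _ ENNReal.ofReal_ne_top]
    refine lintegral_congr fun X => ?_
    change w p.2 * _ = _
    rw [← mul_assoc]
    congr 1
    simp only [F, Finset.mul_sum]
  have hFi : ∀ i j X, ∫⁻ p, F i j p X ∂ν ≤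
      C * edist (particle i X) (particle j X) ^ (-(2 * s)) := by
    intro i j X
    refine le_trans (le_of_eq ?_) (hCle (particle i X) (particle j X))
    have hm : Measurable fun p => F i j p X :=
      (hF i j).comp (measurable_id.prodMk measurable_const)
    simp only [ν]
    rw [lintegral_prod_symm _ hm.aemeasurable]
    refine lintegral_congr fun r => ?_
    simp only [F]
    rw [lintegral_const_mul' _ _ ENNReal.ofReal_ne_top]
    congr 1
    rw [← lintegral_indicator_one
      (Metric.isOpen_ball.measurableSet.inter Metric.isOpen_ball.measurableSet)]
    refine lintegral_congr fun x => ?_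
    rw [Set.inter_indicator_one, Pi.mul_apply]
    simp only [Set.indicator, Metric.mem_ball, Pi.one_apply, dist_comm]
  calc ∫⁻ x, ∫⁻ r in Set.Ioi (0 : ℝ), w r * expectedPairs Ψ x r
      = ∫⁻ p, w p.2 * expectedPairs Ψ p.1 p.2 ∂ν := by
        refine (lintegral_prod (fun p : EuclideanSpace ℝ (Fin d) × ℝ =>
          w p.2 * expectedPairs Ψ p.1 p.2) ?_).symm
        simp only [hpt]
        exact hG.lintegral_prod_right'.aemeasurable
    _ = ∫⁻ X, ∫⁻ p, (∑ i : Fin N, ∑ j ∈ Finset.Ioi i, F i j p X) * ‖Ψ X‖ₑ ^ 2 ∂ν := by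
        simp only [hpt]
        exact lintegral_lintegral_swap hG.aemeasurable
    _ ≤ ∫⁻ X, C * ((∑ i : Fin N, ∑ j ∈ Finset.Ioi i,
          edist (particle i X) (particle j X) ^ (-(2 * s))) * ‖Ψ X‖ₑ ^ 2) := by
        refine lintegral_mono fun X => ?_
        have hFX : ∀ i j, Measurable fun p => F i j p X := fun i j =>
          (hF i j).comp (measurable_id.prodMk measurable_const)
        rw [lintegral_mul_const _ (Finset.measurable_sum _ fun i _ =>
            Finset.measurable_sum _ fun j _ => hFX i j),
          lintegral_finsetSum _ fun i _ => Finset.measurable_sum _ fun j _ => hFX i j, ← mul_assoc]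
        refine mul_le_mul_left ?_ _
        rw [Finset.mul_sum]
        refine Finset.sum_le_sum fun i _ => ?_
        rw [lintegral_finsetSum _ fun j _ => hFX i j, Finset.mul_sum]
        exact Finset.sum_le_sum fun j _ => hFi i j X
    _ = C * interactionForm s Ψ := lintegral_const_mul' _ _ hC

end Energy

/-! ### The Lieb–Thirring inequality -/

theorem mainTheorem1 (d : ℕ) (hd : 1 ≤ d) (s : ℝ) (hs : 0 < s) :
    ∃ C : ℝ, 0 < C ∧ ∀ (N : ℕ) (Ψ : WaveFunction d N), Ψ.MemH s → ‖Ψ‖ = 1 →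
      ENNReal.ofReal C *
          ∫⁻ x : EuclideanSpace ℝ (Fin d), oneBodyDensity Ψ x ^ (1 + 2 * s / (d : ℝ)) ≤
        energyForm s Ψ := by
  obtain ⟨m, hm⟩ := exists_nat_gt s
  have hm1 : 1 ≤ m := by exact_mod_cast hs.trans hm
  obtain ⟨C₀, hC₀, hpt⟩ := exists_rpow_le_lintegral_add_lintegral hd hs hm1
    (A := (m + 1) * 4 ^ m) (Nat.mul_pos m.succ_pos (by positivity))
  obtain ⟨C₁, hC₁, hkin⟩ := exists_lintegral_fwdDiffDensity_le hd hs hm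
  obtain ⟨C₂, hC₂, hint⟩ := exists_lintegral_expectedPairs_le hd hs
  -- adding `1` makes the constant positive, so that it can be inverted
  set K : ℝ≥0∞ := C₀ * (C₁ + C₂) + 1
  have hK : K ≠ ∞ := by finiteness
  have hK0 : K ≠ 0 := (lt_of_lt_of_le one_pos le_add_self).ne'
  refine ⟨K⁻¹.toReal, ENNReal.toReal_pos (ENNReal.inv_ne_zero.2 hK) (ENNReal.inv_ne_top.2 hK0),
    fun N Ψ _ hΨ => ?_⟩
  rw [ENNReal.ofReal_toReal (ENNReal.inv_ne_top.2 hK0), ENNReal.inv_mul_le_iff hK0 hK]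
  have hfin : ∀ᵐ x, oneBodyDensity Ψ x < ∞ :=
    ae_lt_top (measurable_oneBodyDensity Ψ) (by
      rw [lintegral_oneBodyDensity hΨ]
      exact ENNReal.natCast_ne_top N)
  have hDm : Measurable fun x : EuclideanSpace ℝ (Fin d) =>
      ∫⁻ h, ENNReal.ofReal (‖h‖ ^ (-(d + 2 * s))) * fwdDiffDensity m Ψ h x := by
    refine Measurable.lintegral_prod_right' (ν := volume)
      (f := fun p : EuclideanSpace ℝ (Fin d) × EuclideanSpace ℝ (Fin d) =>
        ENNReal.ofReal (‖p.2‖ ^ (-(d + 2 * s))) * fwdDiffDensity m Ψ p.2 p.1) ?_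
    exact Measurable.mul (by fun_prop) (measurable_snd.fwdDiffDensity measurable_fst m Ψ)
  calc ∫⁻ x, oneBodyDensity Ψ x ^ (1 + 2 * s / (d : ℝ))
      ≤ ∫⁻ x, C₀ * ((∫⁻ h, ENNReal.ofReal (‖h‖ ^ (-(d + 2 * s))) * fwdDiffDensity m Ψ h x) +
          ∫⁻ r in Set.Ioi (0 : ℝ),
            ENNReal.ofReal (r ^ (-(1 + d + 2 * s))) * expectedPairs Ψ x r) := by
        refine lintegral_mono_ae ?_
        filter_upwards [hfin] with x hx
        exact hpt _ _ _ hx.ne (fwdDiffDensity_zero (by omega) Ψ x) (expectedPairs_mono Ψ x)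
          fun l _ => volume_ball_mul_oneBodyDensity_le m hΨ x l
    _ ≤ C₀ * (C₁ * (∑ i : Fin N, kineticForm s i Ψ) + C₂ * interactionForm s Ψ) := by
        rw [lintegral_const_mul' _ _ hC₀, lintegral_add_left hDm]
        exact mul_le_mul_right (add_le_add (hkin N Ψ) (hint N Ψ)) _
    _ ≤ C₀ * (C₁ * energyForm s Ψ + C₂ * energyForm s Ψ) := by
        unfold energyForm
        gcongr
        · exact le_self_add
        · exact le_add_self
    _ = C₀ * (C₁ + C₂) * energyForm s Ψ := by ring
    _ ≤ K * energyForm s Ψ := mul_le_mul_left le_self_add _
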